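/- Let $p$ be an odd prime, $\mathbb{F}$ an algebraically closed field of characteristic $p$, $G=SL_2(\mathbb{F}_p)$, and $B\le G$ the subgroup of upper triangular matrices; all modules are right modules. For $a\in\mathbb{Z}$ let $S_a$ be the one-dimensional $\mathbb{F}[B]$-module on which $\begin{pmatrix}\alpha&\beta\\0&\alpha^{-1}\end{pmatrix}$ acts as multiplication by $\alpha^a$. For $1\le t\le p$ let $V_t\subseteq\mathbb{F}[x,y]$ be the space of homogeneous polynomials of degree $t-1$, on which $\begin{pmatrix}\alpha&\beta\\\gamma&\delta\end{pmatrix}\in G$ acts by the substitution $x\mapsto\alpha x+\beta y$, $y\mapsto\gamma x+\delta y$. A non-projective indecomposable $\mathbb{F}[G]$-module $M$ is called a Green correspondent of a non-projective indecomposable $\mathbb{F}[B]$-module $N$ if $\mathrm{Res}^G_B(M)\cong N\oplus Q$ and $\mathrm{Ind}_B^G(N)\cong M\oplus P$ with $Q$ and $P$ projective. Let $0\le a\le p-2$. Then the composition factors of $\mathrm{Ind}_B^G(S_a)$, counted with multiplicity, are $V_{a+1}$ and $V_{p-a}$. If moreover $a\ne 0$, then $\mathrm{Ind}_B^G(S_a)$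 is uniserial with socle isomorphic to $V_{a+1}$ and top isomorphic to $V_{p-a}$, and it is, up to isomorphism, the unique Green correspondent $V_{a,1}$ of $S_a$. -/

import Mathlib

open scoped MonoidAlgebra MatrixGroups

noncomputable section

namespace SLTwo

/-! ### General module theory -/

section Modules

variable (A : Type*) [Ring A] (M : Type*) [AddCommGroup M] [Module A M]

/-- `M` is indecomposable: it is nonzero and not the direct sum of two nonzero submodules. -/
def IsIndecomposable : Prop :=
  Nontrivial M ∧ ∀ N N' : Submodule A M, IsCompl N N' → N = ⊥ ∨ N' = ⊥

/-- `M` is uniserial: its submodules form a chain. -/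
def IsUniserial : Prop :=
  ∀ N N' : Submodule A M, N ≤ N' ∨ N' ≤ N

/-- The socle of `M`: the sum of all simple submodules. -/
def socle : Submodule A M :=
  sSup {N : Submodule A M | IsSimpleModule A N}

/-- The top (head) of `M`: the quotient by the radical, which is the intersection of all maximal
submodules. -/
abbrev Top : Type _ := M ⧸ Module.jacobson A M

/-- The composition factors of `M`, counted with multiplicity and up to isomorphism, are the
modules `N i`: there is a composition series from `0` to `M`, and the subquotients of any
such series are, in some order, isomorphic to the modules `N i`. -/
def HasCompositionFactors {ι : Type*} (N : ι → Type*) [∀ i, AddCommGroup (N i)]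
    [∀ i, Module A (N i)] : Prop :=
  (∃ s : CompositionSeries (Submodule A M), s.head = ⊥ ∧ s.last = ⊤) ∧
  ∀ s : CompositionSeries (Submodule A M), s.head = ⊥ → s.last = ⊤ →
    ∃ e : Fin s.length ≃ ι, ∀ i : Fin s.length,
      Nonempty ((s i.succ ⧸ (s i.castSucc).submoduleOf (s i.succ)) ≃ₗ[A] N (e i))

/-- `M` is the direct sum of a module isomorphic to `N` and a projective module. -/
def IsSumProjective (N : Type*) [AddCommGroup N] [Module A N] : Prop :=
  ∃ N' P : Submodule A M, IsCompl N' P ∧ Nonempty (N' ≃ₗ[A] N) ∧ Module.Projective A P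

end Modules

/-! ### The group `SL₂(𝔽_p)` and its modules

All modules are right modules. A right module over the group algebra of a group `G` is a
representation of the opposite group `Gᵐᵒᵖ`: `ρ (op g) v` is `v · g`. -/

variable (p : ℕ) [Fact p.Prime]

/-- `G = SL₂(𝔽_p)`. -/
abbrev G : Type := SL(2, ZMod p)

/-- The subgroup of upper triangular matrices of `G`. -/
def borel : Subgroup (G p) where
  carrier := {g | g 1 0 = 0}
  one_mem' := by simp
  mul_mem' := by
    intro g h hg hh
    simp only [Set.mem_ofPred_eq] at hg hh ⊢
    simp [Matrix.mul_apply, Fin.sum_univ_two, hg, hh]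
  inv_mem' := by
    intro g hg
    simp only [Set.mem_ofPred_eq] at hg ⊢
    simp [Matrix.SpecialLinearGroup.coe_inv, Matrix.adjugate_fin_two, hg]

/-- The subgroup of upper triangular matrices, inside the opposite group of `G`; its
representations are the right modules of the upper triangular group. -/
abbrev Bop : Subgroup (G p)ᵐᵒᵖ := (borel p).op

variable (F : Type*) [Field F] [CharP F p]

/-- The inclusion of the prime field. -/
abbrev incl : ZMod p →+* F := ZMod.castHom dvd_rfl F

/-- The one-dimensional module `S_a` of the upper triangular group: an upper triangular matrix
with upper left entry `α` acts as multiplication by `α ^ a`. In particular unitriangular matrices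
act trivially and `diag(ζ, ζ⁻¹)` acts as `ζ ^ a`. -/
def S (a : ℤ) : Representation F (Bop p) F where
  toFun b := ((incl p F (b.1.unop 0 0)) ^ a) • LinearMap.id
  map_one' := by
    ext
    simp
  map_mul' b c := by
    have hb : b.1.unop 1 0 = 0 := b.2
    ext
    simp [Matrix.mul_apply, Fin.sum_univ_two, mul_zpow, hb]

/-- The substitution `x ↦ αx + βy`, `y ↦ γx + δy` on `F[x, y]` given by the matrix
`(α β; γ δ)`; here `x` is `X 0` and `y` is `X 1`. -/
def subst (g : G p) : MvPolynomial (Fin 2) F →ₐ[F] MvPolynomial (Fin 2) F :=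
  MvPolynomial.aeval fun i => ∑ j, MvPolynomial.C (incl p F (g i j)) * MvPolynomial.X j

/-- `F[x, y]` as a right module of `G`, acting by substitutions. -/
def polyRep : Representation F (G p)ᵐᵒᵖ (MvPolynomial (Fin 2) F) where
  toFun g := (subst p F g.unop).toLinearMap
  map_one' := by
    have : subst p F (1 : G p) = AlgHom.id F _ := by
      ext i : 1
      fin_cases i <;> simp [subst, Fin.sum_univ_two]
    simp only [MulOpposite.unop_one, this]
    rfl
  map_mul' g h := by
    have : subst p F (h.unop * g.unop) = (subst p F g.unop).comp (subst p F h.unop) := by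
      ext i : 1
      simp [subst, Matrix.mul_apply, Fin.sum_univ_two]
      ring
    simp only [MulOpposite.unop_mul, this]
    rfl

/-- The module `V_t` (for `t ≥ 1`): homogeneous polynomials of degree `t - 1` in `x, y`, with
the action of `G` by substitutions. -/
def V (t : ℕ) :
    Representation F (G p)ᵐᵒᵖ (MvPolynomial.homogeneousSubmodule (Fin 2) F (t - 1)) :=
  (polyRep p F).subrepresentation (MvPolynomial.homogeneousSubmodule (Fin 2) F (t - 1)) (by
    intro g f hf
    have hf' : f.IsHomogeneous (t - 1) := hf
    have : (subst p F g.unop f).IsHomogeneous (1 * (t - 1)) := by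
      refine hf'.aeval _ fun i => ?_
      refine MvPolynomial.IsHomogeneous.sum _ _ _ fun j _ => ?_
      simpa using (MvPolynomial.isHomogeneous_C (Fin 2) (incl p F (g.unop i j))).mul
        (MvPolynomial.isHomogeneous_X F j)
    rw [one_mul] at this
    exact this)

section Green

variable {p F} {W : Type*} [AddCommGroup W] [Module F W]

/-- Restriction from `G` to the upper triangular group. -/
abbrev res (ρ : Representation F (G p)ᵐᵒᵖ W) : Representation F (Bop p) W :=
  ρ.comp (Bop p).subtype

/-- Induction from the upper triangular group to `G`. -/
abbrev ind (σ : Representation F (Bop p) W) :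
    Representation F (G p)ᵐᵒᵖ (Representation.IndV (Bop p).subtype σ) :=
  Representation.ind (Bop p).subtype σ

/-- `ρ` is the Green correspondent of `σ`: both are indecomposable and not projective, the
restriction of `ρ` is the direct sum of `σ` and a projective module, and the module induced from
`σ` is the direct sum of `ρ` and a projective module. -/
structure IsGreenCorrespondent {W' : Type*} [AddCommGroup W'] [Module F W']
    (ρ : Representation F (G p)ᵐᵒᵖ W) (σ : Representation F (Bop p) W') : Prop where
  indecomposable : IsIndecomposable F[(G p)ᵐᵒᵖ] ρ.asModule
  not_projective : ¬ Module.Projective F[(G p)ᵐᵒᵖ] ρ.asModule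
  indecomposable' : IsIndecomposable F[Bop p] σ.asModule
  not_projective' : ¬ Module.Projective F[Bop p] σ.asModule
  res_eq : IsSumProjective F[Bop p] (res ρ).asModule σ.asModule
  ind_eq : IsSumProjective F[(G p)ᵐᵒᵖ] (ind σ).asModule ρ.asModule

end Green

end SLTwo

end

/-!
The module induced from `S_a` is the module of functions on the plane `𝔽_p²` which are homogeneous
of degree `a` and vanish at the origin. Evaluating forms embeds `V_{a+1}` in it, and
`f ↦ ∑ v, f v • (v 0 * y - v 1 * x) ^ (p - 1 - a)` maps it onto `V_{p-a}`. The composite vanishes by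
the power sum argument behind the Chevalley-Warning theorem, and the dimensions
`(a + 1) + (p - a) = p + 1` then make the sequence exact.

By Frobenius reciprocity, an equivariant map from homogeneous functions to `V_{a+1}` is determined
by the image of the function supported on the `B`-stable line. That image is invariant under the
unipotent radical, hence a multiple of `y ^ a`, and comparing the weights of the torus gives
`2 * a = p - 1` if it is nonzero and `0 < a < p - 1`; but then the map is a multiple of the one
above and kills `V_{a+1}`. So the extension does not split, and a nonsplit module of length two is
uniserial.

The functions which vanish on the `B`-stable line are projective over `B` by Higman's criterion: the
required endomorphism is minus the restriction to the line `v 0 = 0`, because the number of elements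
of `B` carrying a given point onto that line is `p - 1 = -1`.
-/

noncomputable section

namespace SLTwo

section Lattice

theorem eq_bot_or_eq_or_eq_top_of_not_isComplemented {α : Type*} [Lattice α] [BoundedOrder α]
    {a : α} (hatom : IsAtom a) (hcoatom : IsCoatom a) (ha : ¬ IsComplemented a) (b : α) :
    b = ⊥ ∨ b = a ∨ b = ⊤ := by
  by_cases hab : a ≤ b
  · exact Or.inr (hcoatom.le_iff.1 hab).symm
  by_cases hba : b ≤ a
  · exact (hatom.le_iff.1 hba).imp_right Or.inl
  · exact absurd ⟨b, hatom.not_le_iff_disjoint.1 hab, hcoatom.not_le_iff_codisjoint.1 hba⟩ ha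

end Lattice

section Uniserial

variable {A : Type*} [Ring A] {M : Type*} [AddCommGroup M] [Module A M]

theorem isUniserial_of_isSimpleModule [IsSimpleModule A M] : IsUniserial A M := fun N _ =>
  (eq_bot_or_eq_top N).imp (fun h => h.trans_le bot_le) fun h => le_top.trans_eq h.symm

theorem IsUniserial.isIndecomposable [Nontrivial M] (h : IsUniserial A M) :
    IsIndecomposable A M :=
  ⟨inferInstance, fun N N' hc =>
    (h N N').imp hc.disjoint.eq_bot_of_le hc.disjoint.symm.eq_bot_of_le⟩

end Uniserial

section LengthTwo

variable {A : Type*} [Ring A] {M : Type*} [AddCommGroup M] [Module A M]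
  {K : Submodule A M} [IsSimpleModule A K] [IsSimpleModule A (M ⧸ K)]

theorem hasCompositionFactors_of_isSimpleModule (N : Fin 2 → Type*) [∀ i, AddCommGroup (N i)]
    [∀ i, Module A (N i)] (e₀ : K ≃ₗ[A] N 0) (e₁ : (M ⧸ K) ≃ₗ[A] N 1) :
    HasCompositionFactors A M N := by
  have hatom : IsAtom K := isSimpleModule_iff_isAtom.1 inferInstance
  have hcoatom : IsCoatom K := isSimpleModule_iff_isCoatom.1 inferInstance
  let s : CompositionSeries (Submodule A M) :=
    { length := 2
      toFun := ![⊥, K, ⊤]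
      step := Fin.forall_fin_two.2 ⟨hatom.bot_covBy, hcoatom.covBy_top⟩ }
  have factor (j : Fin 2) :
      Nonempty ((s j.succ ⧸ (s j.castSucc).submoduleOf (s j.succ)) ≃ₗ[A] N j) := by
    fin_cases j
    · exact ⟨(Submodule.quotEquivOfEqBot _ (Submodule.ker_subtype K)).trans e₀⟩
    · exact ⟨(Submodule.Quotient.equiv (K.submoduleOf ⊤) K Submodule.topEquiv
        (by ext x; simp [Submodule.submoduleOf])).trans e₁⟩
  refine ⟨⟨s, rfl, rfl⟩, fun t ht ht' => ?_⟩
  obtain ⟨e, he⟩ := CompositionSeries.jordan_holder t s ht ht'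
  exact ⟨e, fun i => ⟨(he i).linearEquiv.trans (factor (e i)).some⟩⟩

theorem eq_bot_or_eq_or_eq_top (hK : ¬ IsComplemented K) (N : Submodule A M) :
    N = ⊥ ∨ N = K ∨ N = ⊤ :=
  eq_bot_or_eq_or_eq_top_of_not_isComplemented (isSimpleModule_iff_isAtom.1 inferInstance)
    (isSimpleModule_iff_isCoatom.1 inferInstance) hK N

theorem isUniserial_of_not_isComplemented (hK : ¬ IsComplemented K) : IsUniserial A M := by
  intro N N'
  rcases eq_bot_or_eq_or_eq_top hK N with rfl | rfl | rfl
  · exact Or.inl bot_le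
  · rcases eq_bot_or_eq_or_eq_top hK N' with rfl | rfl | rfl
    exacts [Or.inr bot_le, Or.inl le_rfl, Or.inl le_top]
  · exact Or.inr le_top

theorem isIndecomposable_of_not_isComplemented (hK : ¬ IsComplemented K) :
    IsIndecomposable A M :=
  have := IsSimpleModule.nontrivial A K
  have := K.subtype_injective.nontrivial
  (isUniserial_of_not_isComplemented hK).isIndecomposable

theorem socle_eq_of_not_isComplemented (hK : ¬ IsComplemented K) : socle A M = K := by
  have hcoatom : IsCoatom K := isSimpleModule_iff_isCoatom.1 inferInstance
  refine le_antisymm (sSup_le fun N (hN : IsSimpleModule A N) => ?_)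
    (le_sSup (inferInstance : IsSimpleModule A K))
  rcases eq_bot_or_eq_or_eq_top hK N with rfl | rfl | rfl
  · exact bot_le
  · exact le_rfl
  · have htop : IsAtom (⊤ : Submodule A M) := isSimpleModule_iff_isAtom.1 hN
    obtain rfl : K = ⊥ := (htop.le_iff.1 le_top).resolve_right hcoatom.1
    exact absurd isComplemented_bot hK

theorem jacobson_eq_of_not_isComplemented (hK : ¬ IsComplemented K) :
    Module.jacobson A M = K := by
  have hatom : IsAtom K := isSimpleModule_iff_isAtom.1 inferInstance
  refine le_antisymm (sInf_le (isSimpleModule_iff_isCoatom.1 inferInstance))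
    (le_sInf fun N (hN : IsCoatom N) => ?_)
  rcases eq_bot_or_eq_or_eq_top hK N with rfl | rfl | rfl
  · obtain rfl : K = ⊤ := (hN.le_iff.1 bot_le).resolve_right hatom.1
    exact absurd isComplemented_top hK
  · exact le_rfl
  · exact le_top

end LengthTwo

section Decompositions

variable {A : Type*} [Ring A] {M N : Type*} [AddCommGroup M] [Module A M]
  [AddCommGroup N] [Module A N]

theorem not_isComplemented_range [Nontrivial N] {ι : N →ₗ[A] M} (hι : Function.Injective ι)
    (hzero : ∀ θ : M →ₗ[A] N, θ ∘ₗ ι = 0) : ¬ IsComplemented (LinearMap.range ι) := by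
  rintro ⟨K, hK⟩
  let e := LinearEquiv.ofInjective ι hι
  obtain ⟨n, hn⟩ := exists_ne (0 : N)
  refine hn ?_
  calc n = e.symm (Submodule.projectionOnto _ _ hK (e n : M)) := by
        rw [Submodule.projectionOnto_apply_left, e.symm_apply_apply]
    _ = 0 := LinearMap.congr_fun
        (hzero (e.symm.toLinearMap ∘ₗ Submodule.projectionOnto _ _ hK)) n

theorem IsSumProjective.nonempty_linearEquiv [Nontrivial N] (hM : IsIndecomposable A M)
    (h : IsSumProjective A M N) : Nonempty (N ≃ₗ[A] M) := by
  obtain ⟨N', P, hc, ⟨e⟩, -⟩ := h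
  rcases hM.2 N' P hc with rfl | rfl
  · exact absurd e.toEquiv.nontrivial (not_nontrivial _)
  · obtain rfl : N' = ⊤ := by simpa using hc.sup_eq_top
    exact ⟨e.symm.trans Submodule.topEquiv⟩

theorem isSumProjective_self : IsSumProjective A M M :=
  ⟨⊤, ⊥, isCompl_top_bot, ⟨Submodule.topEquiv⟩, inferInstance⟩

theorem isSumProjective_of_leftInverse {i : N →ₗ[A] M} {q : M →ₗ[A] N}
    (hqi : Function.LeftInverse q i) (hP : Module.Projective A (LinearMap.ker q)) :
    IsSumProjective A M N := by
  have hproj : LinearMap.IsProj (LinearMap.range i) (i ∘ₗ q) :=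
    ⟨fun m => ⟨q m, rfl⟩, by rintro _ ⟨n, rfl⟩; exact congrArg i (hqi n)⟩
  have hc := hproj.isCompl
  rw [LinearMap.ker_comp_of_ker_eq_bot _ (LinearMap.ker_eq_bot.2 hqi.injective)] at hc
  exact ⟨_, _, hc, ⟨(LinearEquiv.ofInjective i hqi.injective).symm⟩, hP⟩

theorem IsSumProjective.of_linearEquiv {M' : Type*} [AddCommGroup M'] [Module A M']
    (h : IsSumProjective A M N) (e : M' ≃ₗ[A] M) : IsSumProjective A M' N := by
  obtain ⟨N', P, hc, ⟨e'⟩, hP⟩ := h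
  exact ⟨N'.comap e.toLinearMap, P.comap e.toLinearMap,
    (Submodule.orderIsoMapComap e).symm.isCompl hc, ⟨(e.ofSubmodule' N').trans e'⟩,
    Module.Projective.of_equiv (e.ofSubmodule' P).symm⟩

end Decompositions

section GroupAlgebra

open MonoidAlgebra

variable {H : Type*} [Group H]

/-- With the converse `exists_sum_single_smul_eq`, this is D. G. Higman's criterion. -/
theorem projective_of_sum_single_smul_eq [Fintype H] {k : Type*} [Field k] {M : Type*}
    [AddCommGroup M] [Module k M] [Module k[H] M] [IsScalarTower k k[H] M] (θ : M →ₗ[k] M)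
    (hθ : ∀ m : M, ∑ g : H, single g⁻¹ (1 : k) • θ (single g (1 : k) • m) = m) :
    Module.Projective k[H] M := by
  let L : (M →₀ k[H]) →ₗ[k[H]] M := Finsupp.linearCombination k[H] id
  obtain ⟨s, hs⟩ := (L.restrictScalars k).exists_rightInverse_of_surjective
    (LinearMap.range_eq_top.2 (Finsupp.linearCombination_id_surjective k[H] M))
  have hs' (m : M) : L (s m) = m := LinearMap.congr_fun hs m
  refine Module.Projective.of_split ((s ∘ₗ θ).sumOfConjugatesEquivariant H) L ?_
  ext m
  simp [LinearMap.sumOfConjugatesEquivariant_apply, LinearMap.conjugate_apply, hs', hθ]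

variable {k : Type*} [Ring k] {M : Type*} [AddCommGroup M] [Module k[H] M]

theorem sum_single_mul_single_one_coeff_eq [Fintype H] (x : k[H]) :
    ∑ g : H, single g (1 : k) * single 1 ((single g⁻¹ (1 : k) * x).coeff 1) = x := by
  classical
  ext h
  simp [coeff_sum]

theorem exists_sum_single_smul_eq [Fintype H] [Module.Projective k[H] M] :
    ∃ θ : M → M, ∀ m : M, ∑ g : H, single g (1 : k) • θ (single g⁻¹ (1 : k) • m) = m := by
  obtain ⟨s, hs⟩ := Module.projective_def.1 ‹Module.Projective k[H] M›
  let E : k[H] →+ k[H] :=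
    { toFun := fun x => single 1 (x.coeff 1)
      map_zero' := by simp
      map_add' := by simp }
  refine ⟨fun m => Finsupp.linearCombination k[H] id (Finsupp.mapRange.addMonoidHom E (s m)),
    fun m => ?_⟩
  conv_rhs => rw [← hs m]
  simp only [← map_smul, ← map_sum]
  congr 1
  ext n : 1
  simpa [Finsupp.finsetSum_apply, E] using sum_single_mul_single_one_coeff_eq (s m n)

theorem sum_eq_zero_of_mul_left_invariant [Fintype H] {R : Type*} [NonAssocSemiring R] {p : ℕ}
    [CharP R p] {u : H} (hu : orderOf u = p) {f : H → R} (hf : ∀ g, f (u * g) = f g) :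
    ∑ g, f g = 0 := by
  classical
  have hpow (n : ℕ) (g : H) : f (u ^ n * g) = f g := by
    induction n with
    | zero => rw [pow_zero, one_mul]
    | succ n ih => rw [pow_succ', mul_assoc, hf, ih]
  have hzpowers (z : Subgroup.zpowers u) (g : H) : f (z * g) = f g := by
    obtain ⟨n, hn⟩ := mem_powers_iff_mem_zpowers.2 z.2
    exact hn ▸ hpow n g
  obtain ⟨T, hT, -⟩ := (Subgroup.zpowers u).exists_isComplement_right 1
  rw [← hT.equiv.symm.sum_comp]
  simp [hT.equiv_symm_apply, hzpowers, Fintype.sum_prod_type_right,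
    Fintype.card_zpowers, hu]

theorem not_projective_of_invariant [Finite H] [Nontrivial k] {p : ℕ} [CharP k p] {u : H}
    (hu : orderOf u = p) {m : M} (hm : single u (1 : k) • m = m) {φ : M →+ k}
    (hφ : ∀ x, φ (single u (1 : k) • x) = φ x) (h1 : φ m = 1) : ¬ Module.Projective k[H] M := by
  intro hP
  have : Fintype H := Fintype.ofFinite H
  obtain ⟨θ, hθ⟩ := exists_sum_single_smul_eq (k := k) (H := H) (M := M)
  have hm' : single u⁻¹ (1 : k) • m = m := by
    conv_lhs => rw [← hm]
    simp [smul_smul, single_mul_single, ← one_def]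
  have hinv (g : H) : φ (single (u * g) (1 : k) • θ (single (u * g)⁻¹ (1 : k) • m)) =
      φ (single g (1 : k) • θ (single g⁻¹ (1 : k) • m)) := by
    have hu_mul : single (u * g) (1 : k) = single u 1 * single g 1 := by simp [single_mul_single]
    have hu_inv : single (u * g)⁻¹ (1 : k) = single g⁻¹ 1 * single u⁻¹ 1 := by
      simp [single_mul_single]
    rw [hu_mul, hu_inv, mul_smul, mul_smul, hm', hφ]
  refine zero_ne_one (α := k) ?_
  calc (0 : k) = ∑ g : H, φ (single g (1 : k) • θ (single g⁻¹ (1 : k) • m)) :=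
        (sum_eq_zero_of_mul_left_invariant hu hinv).symm
    _ = 1 := by rw [← map_sum, hθ, h1]

end GroupAlgebra

section Extraction

theorem mem_of_forall_sum_pow_smul_mem {F : Type*} [Field F] {W : Type*} [AddCommGroup W]
    [Module F W] {ι : Type*} [Fintype ι] {x : ι → F} (hx : Function.Injective x)
    (N : Submodule F W) {n : ℕ} (hn : n < Fintype.card ι) {m : ℕ → W}
    (h : ∀ i, ∑ k ∈ Finset.range (n + 1), x i ^ k • m k ∈ N) {k : ℕ} (hk : k ≤ n) : m k ∈ N := by
  rw [← Submodule.Quotient.mk_eq_zero, ← Module.forall_dual_apply_eq_zero_iff F]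
  intro φ
  let P : Polynomial F := ∑ j ∈ Finset.range (n + 1), Polynomial.monomial j (φ (N.mkQ (m j)))
  have hdeg : P.natDegree < Fintype.card ι :=
    (Polynomial.natDegree_sum_le_of_forall_le _ _ fun j hj =>
      (Polynomial.natDegree_monomial_le _).trans (Finset.mem_range_succ_iff.1 hj)).trans_lt hn
  have heval (i : ι) : P.eval (x i) = φ (N.mkQ (∑ j ∈ Finset.range (n + 1), x i ^ j • m j)) := by
    simp [P, Polynomial.eval_finsetSum, mul_comm]
  have hP : P = 0 := Polynomial.eq_zero_of_natDegree_lt_card_of_eval_eq_zero P hx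
    (fun i => by rw [heval, N.mkQ_apply, (Submodule.Quotient.mk_eq_zero N).2 (h i), map_zero]) hdeg
  have hcoeff : P.coeff k = φ (N.mkQ (m k)) := by
    simp [P, Polynomial.finsetSum_coeff, Polynomial.coeff_monomial, Nat.lt_succ_iff.2 hk]
  rw [← N.mkQ_apply, ← hcoeff, hP, Polynomial.coeff_zero]

end Extraction

section BinaryForms

open MvPolynomial

variable {F : Type*} [CommRing F]

/-- The binary form `∑ c i xⁱ yⁿ⁻ⁱ`; the values `c i` for `i > n` play no role. -/
def binaryForm (n : ℕ) (c : ℕ → F) : MvPolynomial (Fin 2) F :=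
  ∑ i ∈ Finset.range (n + 1), c i • (X 0 ^ i * X 1 ^ (n - i))

theorem binaryForm_congr {n : ℕ} {c c' : ℕ → F} (h : ∀ i ≤ n, c i = c' i) :
    binaryForm n c = binaryForm n c' :=
  Finset.sum_congr rfl fun i hi => by rw [h i (Finset.mem_range_succ_iff.1 hi)]

theorem isHomogeneous_binaryForm (n : ℕ) (c : ℕ → F) : (binaryForm n c).IsHomogeneous n := by
  refine IsHomogeneous.sum _ _ _ fun i hi => ?_
  have h := (isHomogeneous_X_pow (R := F) (0 : Fin 2) i).mul
    (isHomogeneous_X_pow (1 : Fin 2) (n - i))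
  rw [Nat.add_sub_cancel' (Finset.mem_range_succ_iff.1 hi)] at h
  exact (homogeneousSubmodule (Fin 2) F n).smul_mem (c i) h

theorem finsupp_fin_two_eq (d : Fin 2 →₀ ℕ) :
    d = Finsupp.single 0 (d 0) + Finsupp.single 1 (d 1) := by
  ext i
  fin_cases i <;> simp

theorem coeff_binaryForm {n i : ℕ} (c : ℕ → F) (hi : i ≤ n) :
    coeff (Finsupp.single 0 i + Finsupp.single 1 (n - i)) (binaryForm n c) = c i := by
  classical
  have hcoeff (j : ℕ) : coeff (Finsupp.single 0 i + Finsupp.single 1 (n - i))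
      (X 0 ^ j * X 1 ^ (n - j) : MvPolynomial (Fin 2) F) = if j = i then 1 else 0 := by
    rw [X_pow_eq_monomial, X_pow_eq_monomial, monomial_mul, coeff_monomial, one_mul]
    refine if_congr ⟨fun h => by simpa using DFunLike.congr_fun h 0, fun h => by rw [h]⟩ rfl rfl
  simp only [binaryForm, coeff_sum, coeff_smul, hcoeff]
  simp [Nat.lt_succ_iff.2 hi]

theorem eq_binaryForm {n : ℕ} {f : MvPolynomial (Fin 2) F} (hf : f.IsHomogeneous n) :
    f = binaryForm n fun i => coeff (Finsupp.single 0 i + Finsupp.single 1 (n - i)) f := by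
  ext d
  by_cases hd : d.degree = n
  · rw [Finsupp.degree_eq_sum, Fin.sum_univ_two] at hd
    obtain ⟨hle, hsub⟩ : d 0 ≤ n ∧ d 1 = n - d 0 := by omega
    rw [finsupp_fin_two_eq d, hsub, coeff_binaryForm _ hle]
  · rw [hf.coeff_eq_zero hd, (isHomogeneous_binaryForm n _).coeff_eq_zero hd]

/-- The coordinates of a form are its coefficients at `xⁱ yⁿ⁻ⁱ`. -/
def homogeneousSubmoduleEquiv (n : ℕ) :
    homogeneousSubmodule (Fin 2) F n ≃ₗ[F] (Fin (n + 1) → F) where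
  toFun f i := coeff (Finsupp.single 0 (i : ℕ) + Finsupp.single 1 (n - i)) f.1
  map_add' f g := by ext i; simp
  map_smul' c f := by ext i; simp
  invFun c := ⟨binaryForm n fun i => if h : i < n + 1 then c ⟨i, h⟩ else 0,
    isHomogeneous_binaryForm _ _⟩
  left_inv f := Subtype.ext <| Eq.trans
    (binaryForm_congr fun _ hi => dif_pos (Nat.lt_succ_iff.2 hi)) (eq_binaryForm f.2).symm
  right_inv c := funext fun i =>
    (coeff_binaryForm _ (Nat.lt_succ_iff.1 i.2)).trans (dif_pos i.2)

theorem finrank_homogeneousSubmodule [Nontrivial F] (n : ℕ) :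
    Module.finrank F (homogeneousSubmodule (Fin 2) F n) = n + 1 := by
  rw [(homogeneousSubmoduleEquiv n).finrank_eq, Module.finrank_fin_fun]

end BinaryForms

section Simple

open MvPolynomial

variable {p : ℕ} [Fact p.Prime] {F : Type*} [Field F] [CharP F p]

/-- The unitriangular matrix `(1 β; 0 1)`. -/
def upper (β : ZMod p) : G p := ⟨!![1, β; 0, 1], by simp [Matrix.det_fin_two]⟩

/-- The unitriangular matrix `(1 0; γ 1)`. -/
def lower (γ : ZMod p) : G p := ⟨!![1, 0; γ, 1], by simp [Matrix.det_fin_two]⟩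

theorem subst_X (g : G p) (i : Fin 2) :
    subst p F g (X i) = C (incl p F (g i 0)) * X 0 + C (incl p F (g i 1)) * X 1 := by
  simp [subst, Fin.sum_univ_two]

theorem subst_upper_X_zero (β : ZMod p) :
    subst p F (upper β) (X 0) = incl p F β • X 1 + X 0 := by
  rw [subst_X]
  simp [upper, smul_eq_C_mul, add_comm]

theorem subst_upper_X_one (β : ZMod p) : subst p F (upper β) (X 1) = X 1 := by
  rw [subst_X]
  simp [upper]

theorem subst_lower_X_one (γ : ZMod p) :
    subst p F (lower γ) (X 1) = incl p F γ • X 0 + X 1 := by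
  rw [subst_X]
  simp [lower, smul_eq_C_mul]

/-- The coefficient of `βᵏ` in `f(x + βy, y)`, where `f = binaryForm n c`. -/
def shiftCoeff (n : ℕ) (c : ℕ → F) (k : ℕ) : MvPolynomial (Fin 2) F :=
  ∑ i ∈ Finset.range (n + 1), (c i * (i.choose k : F)) • (X 1 ^ k * X 0 ^ (i - k) * X 1 ^ (n - i))

theorem subst_upper_binaryForm (n : ℕ) (c : ℕ → F) (β : ZMod p) :
    subst p F (upper β) (binaryForm n c) =
      ∑ k ∈ Finset.range (n + 1), (incl p F β) ^ k • shiftCoeff n c k := by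
  simp only [binaryForm, shiftCoeff, map_sum, map_smul, map_mul, map_pow, subst_upper_X_zero,
    subst_upper_X_one, Finset.smul_sum]
  rw [Finset.sum_comm]
  refine Finset.sum_congr rfl fun i hi => ?_
  rw [add_pow, Finset.sum_mul, Finset.smul_sum]
  refine Finset.sum_subset_zero_on_sdiff
    (Finset.range_subset_range.2 (Finset.mem_range.1 hi)) (fun k hk => ?_) fun k _ => ?_
  · have hik : i < k := by simpa using (Finset.mem_sdiff.1 hk).2
    simp [Nat.choose_eq_zero_of_lt hik]
  · simp only [smul_eq_C_mul, map_mul, map_pow, map_natCast]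
    ring

theorem shiftCoeff_eq {n d : ℕ} {c : ℕ → F} (hd : d ≤ n) (hc : ∀ i, d < i → i ≤ n → c i = 0) :
    shiftCoeff n c d = c d • X 1 ^ n := by
  rw [shiftCoeff, Finset.sum_eq_single_of_mem d (Finset.mem_range_succ_iff.2 hd)]
  · simp [← pow_add, Nat.add_sub_cancel' hd]
  · intro i hi hid
    rcases hid.lt_or_gt with h | h
    · simp [Nat.choose_eq_zero_of_lt h]
    · simp [hc i h (Finset.mem_range_succ_iff.1 hi)]

theorem exists_leading_index {n : ℕ} {c : ℕ → F} (h : binaryForm n c ≠ 0) :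
    ∃ d ≤ n, c d ≠ 0 ∧ ∀ i, d < i → i ≤ n → c i = 0 := by
  classical
  obtain ⟨i, hi, hci⟩ := Finset.exists_ne_zero_of_sum_ne_zero h
  refine ⟨Nat.findGreatest (fun i => c i ≠ 0) n, Nat.findGreatest_le n,
    Nat.findGreatest_spec (P := fun i => c i ≠ 0) (Finset.mem_range_succ_iff.1 hi)
      (left_ne_zero_of_smul hci), fun j hdj hjn => ?_⟩
  exact not_not.1 (Nat.findGreatest_is_greatest hdj hjn)

/-- If `xᵈ` is the highest power of `x` in `f`, then the coefficient of `βᵈ` in `f(x + βy, y)` is a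
nonzero multiple of `yⁿ`. -/
theorem X_one_pow_mem_of_subst_upper_mem {n : ℕ} (hn : n < p)
    {N : Submodule F (MvPolynomial (Fin 2) F)} {f : MvPolynomial (Fin 2) F}
    (hf : f.IsHomogeneous n) (hf0 : f ≠ 0) (hN : ∀ β : ZMod p, subst p F (upper β) f ∈ N) :
    X 1 ^ n ∈ N := by
  rw [eq_binaryForm hf] at hf0
  obtain ⟨d, hd, hcd, hc⟩ := exists_leading_index hf0
  have hmem := mem_of_forall_sum_pow_smul_mem (incl p F).injective N ((ZMod.card p).symm ▸ hn)
    (fun β => by rw [← subst_upper_binaryForm, ← eq_binaryForm hf]; exact hN β) hd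
  rw [shiftCoeff_eq hd hc] at hmem
  exact (N.smul_mem_iff hcd).1 hmem

theorem exists_eq_smul_X_one_pow {n : ℕ} (hn : n < p) {f : MvPolynomial (Fin 2) F}
    (hf : f.IsHomogeneous n) (hinv : ∀ β : ZMod p, subst p F (upper β) f = f) :
    ∃ c : F, f = c • X 1 ^ n := by
  rcases eq_or_ne f 0 with rfl | hf0
  · exact ⟨0, (zero_smul _ _).symm⟩
  obtain ⟨b, hb⟩ := Submodule.mem_span_singleton.1
    (X_one_pow_mem_of_subst_upper_mem hn hf hf0 fun β => by
      rw [hinv β]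
      exact Submodule.mem_span_singleton_self f)
  have hb0 : b ≠ 0 := by
    rintro rfl
    rw [zero_smul] at hb
    exact pow_ne_zero n (X_ne_zero (1 : Fin 2)) hb.symm
  exact ⟨b⁻¹, by rw [← hb, inv_smul_smul₀ hb0]⟩

theorem homogeneousSubmodule_le_of_subst_lower_mem {n : ℕ} (hn : n < p)
    {N : Submodule F (MvPolynomial (Fin 2) F)}
    (hN : ∀ γ : ZMod p, subst p F (lower γ) (X 1 ^ n) ∈ N) :
    homogeneousSubmodule (Fin 2) F n ≤ N := by
  intro f hf
  rw [eq_binaryForm hf]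
  refine N.sum_mem fun i hi => N.smul_mem _ ?_
  have hin := Finset.mem_range_succ_iff.1 hi
  have hmem := mem_of_forall_sum_pow_smul_mem (incl p F).injective N ((ZMod.card p).symm ▸ hn)
    (m := fun k => (n.choose k : F) • (X 0 ^ k * X 1 ^ (n - k))) (fun γ => by
      convert hN γ using 1
      rw [map_pow, subst_lower_X_one, add_pow]
      refine Finset.sum_congr rfl fun k _ => ?_
      simp only [smul_eq_C_mul, mul_pow, map_pow, map_natCast]
      ring) hin
  refine (N.smul_mem_iff ?_).1 hmem
  rw [Ne, CharP.cast_eq_zero_iff F p]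
  exact fun hdvd => ((Fact.out : p.Prime).factorization_pos_of_dvd
    (Nat.choose_pos hin).ne' hdvd).ne' (Nat.factorization_choose_eq_zero_of_lt hn)

theorem V_apply (t : ℕ) (g : (G p)ᵐᵒᵖ) (f : homogeneousSubmodule (Fin 2) F (t - 1)) :
    (V p F t g f : MvPolynomial (Fin 2) F) = subst p F g.unop f := rfl

instance nontrivial_homogeneousSubmodule (n : ℕ) :
    Nontrivial (homogeneousSubmodule (Fin 2) F n) :=
  Module.nontrivial_of_finrank_pos (R := F) (by simp [finrank_homogeneousSubmodule])

theorem isIrreducible_V {t : ℕ} (ht : t - 1 < p) : (V p F t).IsIrreducible := by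
  have eq_top_of_ne_bot (N : Subrepresentation (V p F t)) (hN : N ≠ ⊥) : N = ⊤ := by
    let N' : Submodule F (MvPolynomial (Fin 2) F) := N.toSubmodule.map (Submodule.subtype _)
    have hN' (g : G p) {f} (hf : f ∈ N') : subst p F g f ∈ N' := by
      obtain ⟨f, hf, rfl⟩ := hf
      exact ⟨V p F t (MulOpposite.op g) f, N.apply_mem_toSubmodule _ hf, rfl⟩
    obtain ⟨f, hfN, hf0⟩ := N.toSubmodule.exists_mem_ne_zero_of_ne_bot fun h =>
      hN (Subrepresentation.toSubmodule_injective h)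
    have hXN : X 1 ^ (t - 1) ∈ N' := X_one_pow_mem_of_subst_upper_mem ht f.2
      (fun h => hf0 (Subtype.ext h)) fun β => hN' (upper β) ⟨f, hfN, rfl⟩
    have hle := homogeneousSubmodule_le_of_subst_lower_mem ht fun γ => hN' (lower γ) hXN
    refine SetLike.ext fun x => ⟨fun _ => trivial, fun _ => ?_⟩
    obtain ⟨y, hy, hyx⟩ := hle x.2
    rwa [← show y = x from Subtype.ext hyx]
  have : Nontrivial (Subrepresentation (V p F t)) := by
    obtain ⟨f, hf⟩ := exists_ne (0 : homogeneousSubmodule (Fin 2) F (t - 1))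
    refine ⟨⊥, ⊤, fun h => hf ?_⟩
    have hmem : f ∈ (⊥ : Subrepresentation (V p F t)) := h ▸ trivial
    exact hmem
  exact ⟨fun N => or_iff_not_imp_left.2 (eq_top_of_ne_bot N)⟩

end Simple

section Plane

variable {p : ℕ}

/-- The plane of column vectors over the prime field, on which `G` acts from the left. -/
abbrev Plane (p : ℕ) : Type := Fin 2 → ZMod p

theorem smul_plane_apply (g : G p) (v : Plane p) (i : Fin 2) :
    (g • v) i = g i 0 * v 0 + g i 1 * v 1 := by
  change (g : Matrix (Fin 2) (Fin 2) (ZMod p)).mulVec v i = _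
  rw [Matrix.mulVec, dotProduct, Fin.sum_univ_two]

/-- The first basis vector; the upper triangular group is the stabilizer of the line it spans. -/
def e₁ : Plane p := ![1, 0]

theorem vec_apply_eq (v : Plane p) : ![v 0, v 1] = v := FinVec.etaExpand_eq v

variable [Fact p.Prime]

theorem e₁_ne_zero : (e₁ : Plane p) ≠ 0 := fun h => one_ne_zero (congrFun h 0)

theorem smul_e₁_ne_zero (g : G p) : g • (e₁ : Plane p) ≠ 0 :=
  fun h => e₁_ne_zero ((smul_eq_zero_iff_eq g).1 h)

theorem smul_e₁ (g : G p) : g • e₁ = ![g 0 0, g 1 0] := by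
  ext i
  rw [smul_plane_apply]
  fin_cases i <;> simp [e₁]

theorem exists_smul_e₁_eq {v : Plane p} (hv : v ≠ 0) : ∃ g : G p, g • e₁ = v := by
  have hcoprime : IsCoprime (v 0) (v 1) := by
    obtain ⟨i, hi⟩ := Function.ne_iff.1 hv
    fin_cases i
    · exact ⟨(v 0)⁻¹, 0, by simpa using inv_mul_cancel₀ hi⟩
    · exact ⟨0, (v 1)⁻¹, by simpa using inv_mul_cancel₀ hi⟩
  obtain ⟨g, h0, h1⟩ := hcoprime.exists_SL2_col 0
  exact ⟨g, by rw [smul_e₁, h0, h1, vec_apply_eq]⟩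

theorem mem_borel {b : G p} : b ∈ borel p ↔ b 1 0 = 0 := Iff.rfl

theorem mul_eq_one_of_mem_borel {b : G p} (hb : b ∈ borel p) : b 0 0 * b 1 1 = 1 := by
  have hdet : b 0 0 * b 1 1 - b 0 1 * b 1 0 = 1 := by rw [← Matrix.det_fin_two, b.det_coe]
  rwa [mem_borel.1 hb, mul_zero, sub_zero] at hdet

theorem apply_zero_zero_ne_zero {b : G p} (hb : b ∈ borel p) : b 0 0 ≠ 0 :=
  left_ne_zero_of_mul_eq_one (mul_eq_one_of_mem_borel hb)

theorem smul_e₁_of_mem_borel {b : G p} (hb : b ∈ borel p) : b • e₁ = b 0 0 • (e₁ : Plane p) := by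
  rw [smul_e₁, mem_borel.1 hb, e₁, Matrix.smul_vec2, smul_eq_mul, mul_one, smul_zero]

end Plane

section FunctionModel

variable {p : ℕ} [Fact p.Prime] {F : Type*} [Field F]

variable (p F) in
/-- The right module of functions on the plane. -/
def funRep : Representation F (G p)ᵐᵒᵖ (Plane p → F) where
  toFun g := LinearMap.funLeft F F (g.unop • ·)
  map_one' := LinearMap.ext fun f => funext fun v => congrArg f (one_smul (G p) v)
  map_mul' g h := LinearMap.ext fun f => funext fun v =>
    congrArg f (mul_smul h.unop g.unop v)

theorem funRep_apply (g : (G p)ᵐᵒᵖ) (f : Plane p → F) (v : Plane p) :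
    funRep p F g f v = f (g.unop • v) := rfl

variable [CharP F p]

variable (p F) in
/-- The functions on the plane which are homogeneous of degree `a` and vanish at the origin: a model
of the module induced from `S_a`. -/
def homFun (a : ℕ) : Submodule F (Plane p → F) where
  carrier := {f | f 0 = 0 ∧ ∀ (c : (ZMod p)ˣ) (v : Plane p),
    f ((c : ZMod p) • v) = incl p F c ^ a * f v}
  zero_mem' := by simp
  add_mem' := by
    rintro f g ⟨hf, hf'⟩ ⟨hg, hg'⟩
    refine ⟨by simp [hf, hg], fun c v => ?_⟩
    rw [Pi.add_apply, hf', hg', Pi.add_apply, mul_add]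
  smul_mem' := by
    rintro r f ⟨hf, hf'⟩
    refine ⟨by simp [hf], fun c v => ?_⟩
    rw [Pi.smul_apply, hf', Pi.smul_apply, smul_eq_mul, smul_eq_mul, mul_left_comm]

variable (p F) in
/-- The right module of homogeneous functions on the plane. -/
def homRep (a : ℕ) : Representation F (G p)ᵐᵒᵖ (homFun p F a) :=
  (funRep p F).subrepresentation (homFun p F a) (by
    rintro g f ⟨hf, hf'⟩
    refine ⟨by rw [funRep_apply, smul_zero, hf], fun c v => ?_⟩
    rw [funRep_apply, smul_comm, hf', funRep_apply])

theorem homRep_apply (a : ℕ) (g : (G p)ᵐᵒᵖ) (f : homFun p F a) (v : Plane p) :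
    (homRep p F a g f).1 v = f.1 (g.unop • v) := rfl

variable {a : ℕ}

theorem homFun_smul (f : homFun p F a) {c : ZMod p} (hc : c ≠ 0) (v : Plane p) :
    f.1 (c • v) = incl p F c ^ a * f.1 v :=
  f.2.2 (Units.mk0 c hc) v

theorem homFun_apply_of_ne_zero (f : homFun p F a) {v : Plane p} (hv : v 1 ≠ 0) :
    f.1 v = incl p F (v 1) ^ a * f.1 ![v 0 / v 1, 1] := by
  rw [← homFun_smul f hv, Matrix.smul_vec2, smul_eq_mul, smul_eq_mul, mul_one,
    mul_div_cancel₀ _ hv, vec_apply_eq]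

variable (p F a) in
/-- The homogeneous function of degree `a` supported on the line spanned by `e₁`, with value `1`
at `e₁`. -/
def axisFun : homFun p F a :=
  ⟨fun v => if v 1 = 0 ∧ v 0 ≠ 0 then incl p F (v 0) ^ a else 0, by simp, fun c v => by
    simp [mul_pow]⟩

theorem axisFun_apply (v : Plane p) :
    (axisFun p F a).1 v = if v 1 = 0 ∧ v 0 ≠ 0 then incl p F (v 0) ^ a else 0 := rfl

theorem axisFun_e₁ : (axisFun p F a).1 e₁ = 1 := by
  simp [axisFun_apply, e₁]

theorem homFun_apply_of_eq_zero (f : homFun p F a) {v : Plane p} (hv : v 1 = 0) :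
    f.1 v = f.1 e₁ * (axisFun p F a).1 v := by
  have hve : v = v 0 • e₁ := by
    rw [e₁, Matrix.smul_vec2, smul_eq_mul, mul_one, smul_zero, ← hv, vec_apply_eq]
  rcases eq_or_ne (v 0) 0 with h0 | h0
  · rw [hve, h0, zero_smul, f.2.1, (axisFun p F a).2.1, mul_zero]
  · rw [hve, homFun_smul f h0, homFun_smul _ h0, axisFun_e₁, mul_one, mul_comm]

theorem homRep_axisFun {b : G p} (hb : b ∈ borel p) :
    homRep p F a (MulOpposite.op b) (axisFun p F a) = incl p F (b 0 0) ^ a • axisFun p F a := by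
  have h11 : b 1 1 ≠ 0 := right_ne_zero_of_mul_eq_one (mul_eq_one_of_mem_borel hb)
  have h00 : b 0 0 ≠ 0 := apply_zero_zero_ne_zero hb
  ext v
  rw [homRep_apply, Submodule.coe_smul, Pi.smul_apply, axisFun_apply, axisFun_apply,
    MulOpposite.unop_op, smul_plane_apply, smul_plane_apply, mem_borel.1 hb]
  by_cases hv : v 1 = 0
  · simp [hv, h00, mul_pow]
  · simp [hv, h11]

/-- The matrix `(0 1; -1 x)`, which maps `(x, 1)` to `e₁`. -/
def affinePointMatrix (x : ZMod p) : G p := ⟨!![0, 1; -1, x], by simp [Matrix.det_fin_two]⟩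

theorem homRep_affinePointMatrix_axisFun (x : ZMod p) (v : Plane p) :
    (homRep p F a (MulOpposite.op (affinePointMatrix x)) (axisFun p F a)).1 v =
      if v 0 = x * v 1 ∧ v 1 ≠ 0 then incl p F (v 1) ^ a else 0 := by
  rw [homRep_apply, axisFun_apply, MulOpposite.unop_op, smul_plane_apply, smul_plane_apply]
  simp [affinePointMatrix, neg_add_eq_zero]

theorem eq_sum_axisFun (f : homFun p F a) :
    f = f.1 e₁ • axisFun p F a + ∑ x : ZMod p, f.1 ![x, 1] •
      homRep p F a (MulOpposite.op (affinePointMatrix x)) (axisFun p F a) := by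
  ext v
  simp only [Submodule.coe_add, Submodule.coe_smul, Submodule.coe_sum, Pi.add_apply,
    Finset.sum_apply, Pi.smul_apply, smul_eq_mul, homRep_affinePointMatrix_axisFun]
  by_cases hv : v 1 = 0
  · simp [hv, ← homFun_apply_of_eq_zero f hv]
  · simp only [axisFun_apply, hv]
    simp [← div_eq_iff hv, hv, homFun_apply_of_ne_zero f hv, mul_comm]

theorem finrank_homFun_le : Module.finrank F (homFun p F a) ≤ p + 1 := by
  let ev : homFun p F a →ₗ[F] (Option (ZMod p) → F) :=
    LinearMap.pi fun o => LinearMap.proj (o.elim e₁ fun x => ![x, 1]) ∘ₗ (homFun p F a).subtype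
  have hev : Function.Injective ev := by
    refine (injective_iff_map_eq_zero ev).2 fun f hf => ?_
    have h_axis : f.1 e₁ = 0 := congrFun hf none
    have h_affine (x : ZMod p) : f.1 ![x, 1] = 0 := congrFun hf (some x)
    rw [eq_sum_axisFun f]
    simp only [h_axis, h_affine, zero_smul, Finset.sum_const_zero, add_zero]
  simpa using LinearMap.finrank_le_finrank_of_injective hev

end FunctionModel

section Induced

variable {p : ℕ} [Fact p.Prime] {F : Type*} [Field F] [CharP F p] {a : ℕ}

theorem S_apply (b : Bop p) (x : F) :
    S p F a b x = incl p F (b.1.unop 0 0) ^ a * x := by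
  simp [S]

instance finite_op : Finite (G p)ᵐᵒᵖ :=
  have : Finite (G p) := Subtype.finite
  Finite.of_equiv (G p) MulOpposite.opEquiv

theorem coind_apply_eq {φ : (G p)ᵐᵒᵖ → F}
    (hφ : φ ∈ Representation.coindV (Bop p).subtype (S p F a)) {g h : G p} {c : ZMod p}
    (hgh : g • e₁ = c • h • (e₁ : Plane p)) :
    φ (MulOpposite.op g) = incl p F c ^ a * φ (MulOpposite.op h) := by
  have hb : (h⁻¹ * g) • e₁ = c • (e₁ : Plane p) := by
    rw [mul_smul, hgh, smul_comm, inv_smul_smul]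
  rw [smul_e₁, e₁, Matrix.smul_vec2, smul_eq_mul, mul_one, smul_zero] at hb
  let b : Bop p := ⟨MulOpposite.op (h⁻¹ * g), congrFun hb 1⟩
  have hmul : MulOpposite.op g = (Bop p).subtype b * MulOpposite.op h := by
    simp [b, ← MulOpposite.op_mul]
  have hc : b.1.unop 0 0 = c := congrFun hb 0
  rw [hmul, hφ, S_apply, hc]

variable (p F a) in
/-- A homogeneous function `f` corresponds to the coinduced function `g ↦ f (g • e₁)`. -/
def homFunToCoind : (homRep p F a).IntertwiningMap
    (Representation.coind (Bop p).subtype (S p F a)) where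
  toFun f := ⟨fun g => f.1 (g.unop • e₁), fun b g => by
    have hb : b.1.unop ∈ borel p := b.2
    change f.1 ((g.unop * b.1.unop) • e₁) = S p F a b (f.1 (g.unop • e₁))
    rw [mul_smul, smul_e₁_of_mem_borel hb, smul_comm, S_apply,
      homFun_smul f (apply_zero_zero_ne_zero hb)]⟩
  map_add' _ _ := rfl
  map_smul' _ _ := rfl
  isIntertwining' g := by
    ext f h
    exact congrArg f.1 (mul_smul g.unop h.unop e₁).symm

theorem homFunToCoind_bijective : Function.Bijective (homFunToCoind p F a) := by
  choose g hg using fun (v : Plane p) (hv : v ≠ 0) => exists_smul_e₁_eq hv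
  refine ⟨fun f f' hff' => ?_, fun φ => ?_⟩
  · ext v
    rcases eq_or_ne v 0 with rfl | hv
    · rw [f.2.1, f'.2.1]
    · rw [← hg v hv]
      exact congrArg (fun φ => φ.1 (MulOpposite.op (g v hv))) hff'
  · classical
    let f : homFun p F a := ⟨fun v => if hv : v = 0 then 0 else φ.1 (MulOpposite.op (g v hv)),
      dif_pos rfl, fun c v => by
        rcases eq_or_ne v 0 with rfl | hv
        · simp
        have hcv : (c : ZMod p) • v ≠ 0 := smul_ne_zero c.ne_zero hv
        simp only [dif_neg hcv, dif_neg hv]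
        exact coind_apply_eq φ.2 (by rw [hg, hg])⟩
    refine ⟨f, Subtype.ext (funext fun h => (dif_neg (smul_e₁_ne_zero h.unop)).trans ?_)⟩
    refine (coind_apply_eq (h := h.unop) (c := 1) φ.2 (by rw [hg, one_smul])).trans ?_
    rw [map_one, one_pow, one_mul, MulOpposite.op_unop]

variable (p F a) in
/-- The module induced from `S_a` is the module of homogeneous functions of degree `a`, since
induction from a subgroup of finite index is coinduction. -/
def indEquiv : (ind (S p F a)).Equiv (homRep p F a) := by
  classical
  exact (Representation.equivOfIso (Rep.indCoindIso (Rep.of (S p F a)))).trans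
    (Representation.Equiv.mk
      (LinearEquiv.ofBijective (homFunToCoind p F a).toLinearMap homFunToCoind_bijective)
      (homFunToCoind p F a).isIntertwining').symm

end Induced

section PowerSums

open MvPolynomial

theorem aeval_smul_of_isHomogeneous {σ R A : Type*} [CommRing R] [CommRing A] [Algebra R A]
    {n : ℕ} {f : MvPolynomial σ R} (hf : f.IsHomogeneous n) (c : A) (x : σ → A) :
    aeval (c • x) f = c ^ n * aeval x f := by
  rw [aeval_def, aeval_def, eval₂_eq, eval₂_eq, Finset.mul_sum]
  refine Finset.sum_congr rfl fun d hd => ?_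
  have hdeg : ∑ i ∈ d.support, d i = n :=
    (DFunLike.congr_fun Finsupp.degree_eq_weight_one d).trans (hf (mem_support_iff.1 hd))
  simp only [Pi.smul_apply, smul_eq_mul, mul_pow, Finset.prod_mul_distrib,
    Finset.prod_pow_eq_pow_sum, hdeg, mul_left_comm]

theorem sum_eval_comp_eq_zero {K R σ : Type*} [Field K] [Fintype K] [CommRing R] [Fintype σ]
    [DecidableEq σ] (φ : K →+* R) (P : MvPolynomial σ R)
    (hP : P.totalDegree < (Fintype.card K - 1) * Fintype.card σ) :
    ∑ x : σ → K, eval (φ ∘ x) P = 0 := by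
  have hmonomial (d : σ →₀ ℕ) (hd : d ∈ P.support) : ∑ x : σ → K, ∏ i, φ (x i) ^ d i = 0 := by
    have h := sum_eval_eq_zero (monomial d (1 : K)) <|
      ((totalDegree_monomial_le d 1).trans (le_totalDegree hd)).trans_lt hP
    simpa [eval_monomial, Finsupp.prod_fintype] using congrArg φ h
  simp only [eval_eq', Function.comp_apply]
  rw [Finset.sum_comm]
  exact Finset.sum_eq_zero fun d hd => by rw [← Finset.mul_sum, hmonomial d hd, mul_zero]

theorem sum_units_smul {p : ℕ} [Fact p.Prime] {M : Type*} (F : Type*) [Ring F] [CharP F p]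
    [AddCommGroup M] [Module F M] (w : M) : ∑ _c : (ZMod p)ˣ, w = -w := by
  have hp : (p : F) • w = 0 := by rw [CharP.cast_eq_zero, zero_smul]
  rw [Finset.sum_const, Finset.card_univ, ZMod.card_units, ← Nat.cast_smul_eq_nsmul F,
    Nat.cast_pred (Fact.out : p.Prime).pos, sub_smul, hp, one_smul, zero_sub]

end PowerSums

section Maps

open MvPolynomial

variable {p : ℕ} [Fact p.Prime] {F : Type*} [Field F] [CharP F p]

/-- The value of a polynomial at a point of the plane over the prime field. -/
def evalAt (v : Plane p) : MvPolynomial (Fin 2) F →ₐ[F] F := aeval (incl p F ∘ v)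

theorem evalAt_subst (g : G p) (v : Plane p) (f : MvPolynomial (Fin 2) F) :
    evalAt v (subst p F g f) = evalAt (g • v) f := by
  have h : (evalAt v).comp (subst p F g) = evalAt (F := F) (g • v) := by
    ext i
    simp [evalAt, subst_X, smul_plane_apply]
  exact DFunLike.congr_fun h f

theorem evalAt_smul {n : ℕ} {f : MvPolynomial (Fin 2) F} (hf : f.IsHomogeneous n) (c : ZMod p)
    (v : Plane p) : evalAt (c • v) f = incl p F c ^ n * evalAt v f := by
  rw [evalAt, evalAt, ← aeval_smul_of_isHomogeneous hf]
  exact congrArg (aeval · f) (funext fun i => map_mul (incl p F) c (v i))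

variable (p F) in
/-- Binary forms of degree `a` as homogeneous functions on the plane. The value at the origin has to
be prescribed because nonzero constants do not vanish there. -/
def formToFun (a : ℕ) : (V p F (a + 1)).IntertwiningMap (homRep p F a) where
  toFun f := ⟨fun v => if v = 0 then 0 else evalAt v f.1, if_pos rfl, fun c v => by
    simp [evalAt_smul (n := a) f.2]⟩
  map_add' f g := by
    ext v
    by_cases hv : v = 0 <;> simp [hv]
  map_smul' c f := by
    ext v
    by_cases hv : v = 0 <;> simp [hv]
  isIntertwining' g := by
    ext f v
    change ite _ _ (evalAt v (subst p F g.unop f.1)) = ite (g.unop • v = 0) _ (evalAt _ f.1)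
    rw [evalAt_subst]
    exact if_congr (smul_eq_zero_iff_eq g.unop).symm rfl rfl

theorem formToFun_apply (a : ℕ) (f : homogeneousSubmodule (Fin 2) F (a + 1 - 1)) (v : Plane p) :
    (formToFun p F a f).1 v = if v = 0 then 0 else evalAt v f.1 := rfl

variable (F) in
/-- The linear form `v 0 * y - v 1 * x`, which vanishes at `v`. -/
def linForm (v : Plane p) : MvPolynomial (Fin 2) F :=
  C (incl p F (v 0)) * X 1 - C (incl p F (v 1)) * X 0

theorem linForm_zero : linForm F (0 : Plane p) = 0 := by
  simp [linForm]

theorem linForm_e₁ : linForm F (e₁ : Plane p) = X 1 := by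
  simp [linForm, e₁]

theorem linForm_smul (c : ZMod p) (v : Plane p) :
    linForm F (c • v) = incl p F c • linForm F v := by
  simp [linForm, smul_eq_C_mul, mul_sub, mul_assoc]

theorem isHomogeneous_linForm (v : Plane p) : (linForm F v).IsHomogeneous 1 :=
  (isHomogeneous_C_mul_X _ 1).sub (isHomogeneous_C_mul_X _ 0)

theorem subst_linForm (g : G p) (v : Plane p) :
    subst p F g (linForm F (g • v)) = linForm F v := by
  have hdet : g 0 0 * g 1 1 - g 0 1 * g 1 0 = 1 := by rw [← Matrix.det_fin_two, g.det_coe]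
  have hdet' : (C (incl p F (g 0 0)) * C (incl p F (g 1 1)) -
      C (incl p F (g 0 1)) * C (incl p F (g 1 0)) : MvPolynomial (Fin 2) F) = 1 := by
    simp only [← map_mul, ← map_sub, hdet, map_one]
  simp only [linForm, map_sub, map_mul, subst_X, algHom_C, smul_plane_apply, map_add,
    algebraMap_eq]
  linear_combination (C (incl p F (v 0)) * X 1 - C (incl p F (v 1)) * X 0) * hdet'

variable (F) in
/-- The transform `f ↦ ∑ f(v) (v 0 * y - v 1 * x)ᵐ` of functions on the plane to binary forms of
degree `m`; it is `G`-equivariant because the determinant pairing of the plane is. -/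
def transform (m : ℕ) (f : Plane p → F) : MvPolynomial (Fin 2) F :=
  ∑ v, f v • linForm F v ^ m

theorem isHomogeneous_transform (m : ℕ) (f : Plane p → F) :
    (transform F m f).IsHomogeneous m := by
  have hpow (v : Plane p) : (linForm F v ^ m).IsHomogeneous m := by
    simpa only [one_mul] using (isHomogeneous_linForm v).pow m
  exact (homogeneousSubmodule (Fin 2) F m).sum_mem fun v _ =>
    (homogeneousSubmodule (Fin 2) F m).smul_mem _ (hpow v)

theorem transform_funRep (m : ℕ) (g : (G p)ᵐᵒᵖ) (f : Plane p → F) :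
    transform F m (funRep p F g f) = subst p F g.unop (transform F m f) := by
  rw [transform, transform, map_sum]
  refine Fintype.sum_equiv (MulAction.toPerm g.unop) _ _ fun v => ?_
  rw [MulAction.toPerm_apply, map_smul, map_pow, subst_linForm, funRep_apply]

variable (p F) in
/-- The transform as a homomorphism from homogeneous functions to binary forms. -/
def funToForm (a t : ℕ) : (homRep p F a).IntertwiningMap (V p F t) where
  toFun f := ⟨transform F (t - 1) f.1, isHomogeneous_transform (t - 1) f.1⟩
  map_add' f g := Subtype.ext <| by simp [transform, add_smul, Finset.sum_add_distrib]
  map_smul' c f := Subtype.ext <| by simp [transform, mul_smul, Finset.smul_sum]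
  isIntertwining' g := LinearMap.ext fun f => Subtype.ext (transform_funRep (t - 1) g f.1)

theorem funToForm_apply (a t : ℕ) (f : homFun p F a) :
    (funToForm p F a t f).1 = transform F (t - 1) f.1 := rfl

theorem transform_axisFun {a m : ℕ} (h : a + m = p - 1) :
    transform F m (axisFun p F a).1 = -X 1 ^ m := by
  have hunit (c : (ZMod p)ˣ) :
      (axisFun p F a).1 ((c : ZMod p) • e₁) • linForm F ((c : ZMod p) • e₁) ^ m = X 1 ^ m := by
    rw [(axisFun p F a).2.2, axisFun_e₁, mul_one, linForm_smul, linForm_e₁, smul_pow, smul_smul,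
      ← pow_add, h, ← map_pow, ← Units.val_pow_eq_pow_val, ZMod.units_pow_card_sub_one_eq_one,
      Units.val_one, map_one, one_smul]
  rw [← sum_units_smul (p := p) F, transform]
  refine (Finset.sum_of_injOn (fun c : (ZMod p)ˣ => (c : ZMod p) • e₁) (fun c _ c' _ hcc' => ?_)
    (fun _ _ => Finset.mem_univ _) (fun v _ hv => ?_) fun c _ => (hunit c).symm).symm
  · exact Units.ext (smul_left_injective _ e₁_ne_zero hcc')
  · rw [axisFun_apply, if_neg, zero_smul]
    rintro ⟨hv1, hv0⟩
    refine hv ⟨Units.mk0 _ hv0, Finset.mem_coe.2 (Finset.mem_univ _), ?_⟩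
    change v 0 • e₁ = v
    rw [e₁, Matrix.smul_vec2, smul_eq_mul, mul_one, smul_zero, ← hv1, vec_apply_eq]

theorem sum_evalAt_smul_linForm_pow_eq_zero {f : MvPolynomial (Fin 2) F} {m : ℕ}
    (h : f.totalDegree + m < 2 * (p - 1)) :
    ∑ v : Plane p, evalAt v f • linForm F v ^ m = 0 := by
  let φ : ZMod p →+* MvPolynomial (Fin 2) F := C.comp (incl p F)
  let L : MvPolynomial (Fin 2) (MvPolynomial (Fin 2) F) := X 0 * C (X 1) - X 1 * C (X 0)
  have hL : L.totalDegree ≤ 1 :=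
    IsHomogeneous.totalDegree_le (((isHomogeneous_X _ 0).mul (isHomogeneous_C _ _)).sub
      ((isHomogeneous_X _ 1).mul (isHomogeneous_C _ _)))
  have hdeg : (map C f * L ^ m).totalDegree < (Fintype.card (ZMod p) - 1) * Fintype.card (Fin 2) :=
    calc (map C f * L ^ m).totalDegree
      _ ≤ (map C f).totalDegree + (L ^ m).totalDegree := totalDegree_mul _ _
      _ ≤ f.totalDegree + m * 1 := add_le_add (Finset.sup_mono (support_map_subset _ _))
          ((totalDegree_pow L m).trans (Nat.mul_le_mul_left m hL))
      _ < _ := by rwa [mul_one, ZMod.card, Fintype.card_fin, mul_comm]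
  refine Eq.trans (Finset.sum_congr rfl fun v _ => ?_)
    (sum_eval_comp_eq_zero φ _ hdeg)
  have hf : eval (φ ∘ v) (map C f) = C (evalAt v f) := by
    rw [eval_map, evalAt, aeval_def]
    exact (eval₂_comp_left C (RingHom.id F) (incl p F ∘ v) f).symm
  have hLv : eval (φ ∘ v) L = linForm F v := by simp [φ, L, linForm]
  rw [map_mul, map_pow, hf, hLv, smul_eq_C_mul]

theorem funToForm_formToFun {a t : ℕ} (h : a + (t - 1) = p - 1)
    (f : homogeneousSubmodule (Fin 2) F (a + 1 - 1)) :
    funToForm p F a t (formToFun p F a f) = 0 := by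
  have hp := (Fact.out : p.Prime).two_le
  have hdeg : f.1.totalDegree ≤ a := IsHomogeneous.totalDegree_le f.2
  refine Subtype.ext <| Eq.trans (Finset.sum_congr rfl fun v _ => ?_)
    (sum_evalAt_smul_linForm_pow_eq_zero (p := p) (f := f.1) (m := t - 1) (by omega))
  rw [formToFun_apply]
  split_ifs with hv
  · rcases eq_or_ne (t - 1) 0 with ht | ht
    · have hf0 := evalAt_smul (n := a) f.2 (0 : ZMod p) v
      rw [zero_smul, map_zero, zero_pow (by omega), zero_mul] at hf0
      rw [hv, hf0]
    · rw [hv, linForm_zero, zero_pow ht, smul_zero, smul_zero]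
  · rfl

end Maps

section HomSpaces

open MvPolynomial

variable {p : ℕ} [Fact p.Prime] {F : Type*} [Field F] [CharP F p] {a : ℕ}

theorem intertwiningMap_ext {W : Type*} [AddCommGroup W] [Module F W]
    {ρ : Representation F (G p)ᵐᵒᵖ W} {θ θ' : (homRep p F a).IntertwiningMap ρ}
    (h : θ (axisFun p F a) = θ' (axisFun p F a)) : θ = θ' := by
  refine DFunLike.ext _ _ fun f => ?_
  rw [eq_sum_axisFun f]
  simp only [map_add, map_smul, map_sum, Representation.IntertwiningMap.isIntertwining, h]

theorem upper_mem_borel (β : ZMod p) : upper β ∈ borel p :=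
  rfl

theorem homRep_upper_axisFun (β : ZMod p) :
    homRep p F a (MulOpposite.op (upper β)) (axisFun p F a) = axisFun p F a := by
  rw [homRep_axisFun (upper_mem_borel β)]
  simp [upper]

theorem exists_map_axisFun_eq {t : ℕ} (ht : t - 1 < p)
    (θ : (homRep p F a).IntertwiningMap (V p F t)) :
    ∃ c : F, (θ (axisFun p F a)).1 = c • X 1 ^ (t - 1) :=
  exists_eq_smul_X_one_pow ht (θ (axisFun p F a)).2 fun β => by
    conv_rhs => rw [← homRep_upper_axisFun β, θ.isIntertwining]
    rfl

/-- The diagonal matrix with entries `α` and `α⁻¹`. -/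
def diag (α : (ZMod p)ˣ) : G p :=
  ⟨!![(α : ZMod p), 0; 0, (α : ZMod p)⁻¹], by
    rw [Matrix.det_fin_two_of, mul_inv_cancel₀ α.ne_zero, mul_zero, sub_zero]⟩

theorem homRep_diag_axisFun (α : (ZMod p)ˣ) :
    homRep p F a (MulOpposite.op (diag α)) (axisFun p F a) =
      incl p F α ^ a • axisFun p F a :=
  homRep_axisFun (b := diag α) rfl

theorem subst_diag_X_one (α : (ZMod p)ˣ) :
    subst p F (diag α) (X 1) = (incl p F α)⁻¹ • X 1 := by
  rw [subst_X]
  simp [diag, smul_eq_C_mul, -ZMod.inv_coe_unit, map_inv₀]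

theorem sub_one_dvd_of_intertwiningMap_ne_zero {t : ℕ} (ht : t - 1 < p)
    {θ : (homRep p F a).IntertwiningMap (V p F t)} (hθ : θ ≠ 0) : p - 1 ∣ a + (t - 1) := by
  obtain ⟨c, hc⟩ := exists_map_axisFun_eq ht θ
  have hθ_axis : (θ (axisFun p F a)).1 ≠ 0 := fun h =>
    hθ (intertwiningMap_ext (Subtype.ext h))
  rw [← ZMod.card p, ← FiniteField.forall_pow_eq_one_iff]
  intro α
  have hα : incl p F α ≠ 0 := (map_ne_zero _).2 α.ne_zero
  have h := congrArg Subtype.val <| Representation.IntertwiningMap.isIntertwining _ _ θ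
    (MulOpposite.op (diag α)) (axisFun p F a)
  rw [homRep_diag_axisFun, map_smul, Submodule.coe_smul, V_apply, MulOpposite.unop_op, hc,
    map_smul, map_pow, subst_diag_X_one, smul_pow, smul_comm c, ← hc] at h
  have hpow : incl p F α ^ a = (incl p F α)⁻¹ ^ (t - 1) := smul_left_injective F hθ_axis h
  refine Units.ext ((incl p F).injective ?_)
  rw [Units.val_pow_eq_pow_val, map_pow, pow_add, hpow, ← mul_pow, inv_mul_cancel₀ hα, one_pow,
    Units.val_one, map_one]

theorem exists_eq_smul_funToForm {t : ℕ} (ht : t - 1 < p) (h : a + (t - 1) = p - 1)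
    (θ : (homRep p F a).IntertwiningMap (V p F t)) : ∃ c : F, θ = c • funToForm p F a t := by
  obtain ⟨c, hc⟩ := exists_map_axisFun_eq ht θ
  refine ⟨-c, intertwiningMap_ext (Subtype.ext ?_)⟩
  change _ = -c • transform F (t - 1) (axisFun p F a).1
  rw [hc, transform_axisFun h, smul_neg, neg_smul, neg_neg]

theorem map_formToFun_eq_zero (ha0 : a ≠ 0) (ha : a < p - 1)
    (θ : (homRep p F a).IntertwiningMap (V p F (a + 1)))
    (f : homogeneousSubmodule (Fin 2) F (a + 1 - 1)) : θ (formToFun p F a f) = 0 := by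
  by_cases hθ : θ = 0
  · rw [hθ]
    rfl
  have ht : a + 1 - 1 < p := by omega
  have h : a + (a + 1 - 1) = p - 1 := by
    have hdvd := sub_one_dvd_of_intertwiningMap_ne_zero ht hθ
    exact Nat.eq_of_dvd_of_lt_two_mul (by omega) hdvd (by omega)
  obtain ⟨c, rfl⟩ := exists_eq_smul_funToForm ht h θ
  exact (congrArg (c • ·) (funToForm_formToFun h f)).trans (smul_zero c)

theorem formToFun_injective (ha : a < p) : Function.Injective (formToFun p F a) := by
  have := isIrreducible_V (p := p) (F := F) (t := a + 1) ha
  refine (Representation.IsIrreducible.injective_or_eq_zero (formToFun p F a)).resolve_right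
    fun h => ?_
  let x : homogeneousSubmodule (Fin 2) F (a + 1 - 1) := ⟨X 0 ^ a, isHomogeneous_X_pow _ _⟩
  have hx : (formToFun p F a x).1 e₁ = 0 := by rw [h]; rfl
  rw [formToFun_apply, if_neg e₁_ne_zero] at hx
  simp [x, evalAt, e₁] at hx

theorem funToForm_surjective {t : ℕ} (ht : t - 1 < p) (h : a + (t - 1) = p - 1) :
    Function.Surjective (funToForm p F a t) := by
  have := isIrreducible_V (F := F) ht
  refine (Representation.IsIrreducible.surjective_or_eq_zero
    (funToForm p F a t)).resolve_right fun h0 => ?_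
  have hx : (funToForm p F a t (axisFun p F a)).1 = 0 := by rw [h0]; rfl
  rw [funToForm_apply, transform_axisFun h, neg_eq_zero] at hx
  exact pow_ne_zero _ (X_ne_zero 1) hx

theorem exact_formToFun_funToForm (ha : a < p) :
    Function.Exact (formToFun p F a) (funToForm p F a (p - a)) := by
  let ι := (formToFun p F a).toLinearMap
  let π := (funToForm p F a (p - a)).toLinearMap
  have hι : Module.finrank F (LinearMap.range ι) = a + 1 := by
    rw [LinearMap.finrank_range_of_inj (formToFun_injective ha), finrank_homogeneousSubmodule,
      Nat.add_sub_cancel]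
  have hπ : LinearMap.range π = ⊤ :=
    LinearMap.range_eq_top.2 (funToForm_surjective (by omega) (by omega))
  have hrank := π.finrank_range_add_finrank_ker
  rw [hπ, finrank_top, finrank_homogeneousSubmodule] at hrank
  have hle : LinearMap.range ι ≤ LinearMap.ker π := by
    rintro _ ⟨f, rfl⟩
    exact funToForm_formToFun (by omega) f
  have hdim := finrank_homFun_le (p := p) (F := F) (a := a)
  exact LinearMap.exact_iff.2 (Submodule.eq_of_le_of_finrank_le hle (by omega)).symm

end HomSpaces

section AsModule

variable {k H V W : Type*} [Field k] [Group H] [AddCommGroup V] [Module k V] [AddCommGroup W]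
  [Module k W] {ρ : Representation k H V} {σ : Representation k H W}

/-- An intertwining map as a linear map over the group algebra. -/
abbrev toModuleHom (f : ρ.IntertwiningMap σ) : ρ.asModule →ₗ[k[H]] σ.asModule :=
  Representation.IntertwiningMap.equivLinearMapAsModule ρ σ f

/-- An equivalence of representations as a linear equivalence over the group algebra. -/
def toModuleEquiv (e : ρ.Equiv σ) : ρ.asModule ≃ₗ[k[H]] σ.asModule :=
  LinearEquiv.ofBijective (toModuleHom e.toIntertwiningMap) e.toLinearEquiv.bijective

theorem single_one_smul (h : H) (x : ρ.asModule) :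
    MonoidAlgebra.single h (1 : k) • x = ρ h x := by
  rw [Representation.single_smul, one_smul]
  rfl

theorem isSumProjective_of_intertwiningMap [Fintype H] {i : σ.IntertwiningMap ρ}
    {q : ρ.IntertwiningMap σ} (hqi : Function.LeftInverse q i) (θ : V →ₗ[k] V)
    (hθ : ∀ v, q v = 0 → q (θ v) = 0) (h : ∀ v, q v = 0 → ∑ g : H, ρ g⁻¹ (θ (ρ g v)) = v) :
    IsSumProjective k[H] ρ.asModule σ.asModule := by
  refine isSumProjective_of_leftInverse (i := toModuleHom i) (q := toModuleHom q) hqi ?_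
  let K := LinearMap.ker (toModuleHom q)
  let θK : K →ₗ[k] K :=
    { toFun v := ⟨θ v.1, hθ v.1 v.2⟩
      map_add' v w := Subtype.ext (θ.map_add v.1 w.1)
      map_smul' c v := Subtype.ext (θ.map_smul c v.1) }
  refine projective_of_sum_single_smul_eq (k := k) (M := K) θK fun v => Subtype.ext ?_
  rw [Submodule.coe_sum]
  refine Eq.trans (Finset.sum_congr rfl fun g _ => ?_) (h v.1 v.2)
  rw [Submodule.coe_smul, single_one_smul]
  exact congrArg (fun x => ρ g⁻¹ (θ x)) (single_one_smul g v.1)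

end AsModule

section InducedModule

variable (p : ℕ) [Fact p.Prime] (F : Type*) [Field F] [CharP F p] (a : ℕ)

/-- The embedding of binary forms of degree `a` into the module induced from `S_a`. -/
def formToInd : (V p F (a + 1)).asModule →ₗ[F[(G p)ᵐᵒᵖ]] (ind (S p F a)).asModule :=
  (toModuleEquiv (indEquiv p F a)).symm.toLinearMap ∘ₗ toModuleHom (formToFun p F a)

/-- The projection of the module induced from `S_a` onto binary forms of degree `p - 1 - a`. -/
def indToForm : (ind (S p F a)).asModule →ₗ[F[(G p)ᵐᵒᵖ]] (V p F (p - a)).asModule :=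
  toModuleHom (funToForm p F a (p - a)) ∘ₗ (toModuleEquiv (indEquiv p F a)).toLinearMap

variable {p F a}

theorem isSimpleModule_V {t : ℕ} (ht : t - 1 < p) :
    IsSimpleModule F[(G p)ᵐᵒᵖ] (V p F t).asModule :=
  (Representation.irreducible_iff_isSimpleModule_asModule _).1 (isIrreducible_V ht)

theorem formToInd_injective (ha : a < p) : Function.Injective (formToInd p F a) :=
  (toModuleEquiv (indEquiv p F a)).symm.injective.comp (formToFun_injective ha)

theorem indToForm_surjective (ha : a < p) : Function.Surjective (indToForm p F a) :=
  (funToForm_surjective (by omega) (by omega)).comp (toModuleEquiv (indEquiv p F a)).surjective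

theorem exact_formToInd_indToForm (ha : a < p) :
    Function.Exact (formToInd p F a) (indToForm p F a) := fun y =>
  (exact_formToFun_funToForm ha (indEquiv p F a y)).trans
    (exists_congr fun _ => (toModuleEquiv (indEquiv p F a)).symm_apply_eq.symm)

variable (p F a) in
/-- The submodule of the module induced from `S_a` which consists of the binary forms of degree
`a`. -/
def formSubmodule : Submodule F[(G p)ᵐᵒᵖ] (ind (S p F a)).asModule :=
  LinearMap.range (formToInd p F a)

/-- The submodule `formSubmodule` is a copy of `V_{a+1}`. -/
def formSubmoduleEquiv (ha : a < p) :
    formSubmodule p F a ≃ₗ[F[(G p)ᵐᵒᵖ]] (V p F (a + 1)).asModule :=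
  (LinearEquiv.ofInjective (formToInd p F a) (formToInd_injective ha)).symm

/-- The quotient by `formSubmodule` is a copy of `V_{p-a}`. -/
def quotientFormSubmoduleEquiv (ha : a < p) :
    ((ind (S p F a)).asModule ⧸ formSubmodule p F a) ≃ₗ[F[(G p)ᵐᵒᵖ]] (V p F (p - a)).asModule :=
  Function.Exact.linearEquivOfSurjective (M := (V p F (a + 1)).asModule)
    (N := (ind (S p F a)).asModule) (P := (V p F (p - a)).asModule)
    (exact_formToInd_indToForm ha) (indToForm_surjective ha)

theorem isSimpleModule_formSubmodule (ha : a < p) :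
    IsSimpleModule F[(G p)ᵐᵒᵖ] (formSubmodule p F a) :=
  have := isSimpleModule_V (F := F) (t := a + 1) ha
  IsSimpleModule.congr (N := (V p F (a + 1)).asModule) (formSubmoduleEquiv ha)

theorem isSimpleModule_quotient_formSubmodule (ha : a < p) :
    IsSimpleModule F[(G p)ᵐᵒᵖ] ((ind (S p F a)).asModule ⧸ formSubmodule p F a) :=
  have := isSimpleModule_V (p := p) (F := F) (t := p - a) (by omega)
  IsSimpleModule.congr (N := (V p F (p - a)).asModule) (quotientFormSubmoduleEquiv ha)

theorem not_isComplemented_formSubmodule (ha0 : a ≠ 0) (ha : a < p - 1) :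
    ¬ IsComplemented (formSubmodule p F a) := by
  have hap : a < p := by omega
  have := isSimpleModule_V (F := F) (t := a + 1) hap
  have := IsSimpleModule.nontrivial F[(G p)ᵐᵒᵖ] (V p F (a + 1)).asModule
  refine not_isComplemented_range (M := (ind (S p F a)).asModule) (N := (V p F (a + 1)).asModule)
    (formToInd_injective hap) fun θ => LinearMap.ext fun f => ?_
  let e := toModuleEquiv (indEquiv p F a)
  exact map_formToFun_eq_zero ha0 ha
    ((Representation.IntertwiningMap.equivLinearMapAsModule _ _).symm (θ ∘ₗ e.symm.toLinearMap)) f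

end InducedModule

section GreenCorrespondence

variable {p : ℕ} [Fact p.Prime] {F : Type*} [Field F]

theorem coe_upper (β : ZMod p) :
    (upper β : Matrix (Fin 2) (Fin 2) (ZMod p)) = !![1, β; 0, 1] := rfl

theorem upper_one_pow (n : ℕ) : upper (1 : ZMod p) ^ n = upper (n : ZMod p) := by
  apply Subtype.ext
  rw [Matrix.SpecialLinearGroup.coe_pow, coe_upper, coe_upper]
  induction n with
  | zero => rw [pow_zero, Nat.cast_zero, Matrix.one_fin_two]
  | succ n ih => simp [pow_succ, ih, add_comm]

theorem orderOf_op_upper_one : orderOf (MulOpposite.op (upper (1 : ZMod p))) = p := by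
  refine orderOf_eq_prime ?_ fun h => ?_
  · rw [← MulOpposite.op_pow, upper_one_pow, CharP.cast_eq_zero, ← Nat.cast_zero, ← upper_one_pow,
      pow_zero, MulOpposite.op_one]
  · have h01 := congrArg (fun g : (G p)ᵐᵒᵖ => g.unop 0 1) h
    simp [coe_upper] at h01

variable [CharP F p] {a : ℕ}

theorem not_projective_homRep : ¬ Module.Projective F[(G p)ᵐᵒᵖ] (homRep p F a).asModule := by
  let φ : homFun p F a →ₗ[F] F := LinearMap.proj e₁ ∘ₗ (homFun p F a).subtype
  refine not_projective_of_invariant (M := (homRep p F a).asModule) (m := axisFun p F a)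
    (φ := φ.toAddMonoidHom) orderOf_op_upper_one
    ((single_one_smul (ρ := homRep p F a) _ _).trans (homRep_upper_axisFun 1)) (fun f => ?_)
    axisFun_e₁
  rw [single_one_smul]
  exact congrArg (Subtype.val f)
    ((smul_e₁_of_mem_borel (upper_mem_borel 1)).trans (one_smul (ZMod p) e₁))

theorem not_projective_S : ¬ Module.Projective F[Bop p] (S p F a).asModule := by
  let u : Bop p := ⟨MulOpposite.op (upper 1), upper_mem_borel 1⟩
  have hu (x : F) : S p F a u x = x := by
    rw [S_apply]
    simp [u, coe_upper]
  refine not_projective_of_invariant (M := (S p F a).asModule) (u := u) (m := (1 : F))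
    (φ := AddMonoidHom.id F) (by rw [← Subgroup.orderOf_coe]; exact orderOf_op_upper_one)
    ((single_one_smul (ρ := S p F a) _ _).trans (hu 1)) (fun x => ?_) rfl
  rw [single_one_smul]
  exact hu x

theorem isSimpleModule_S : IsSimpleModule F[Bop p] (S p F a).asModule := by
  rw [← Representation.irreducible_iff_isSimpleModule_asModule]
  have : Nontrivial (Subrepresentation (S p F a)) := by
    refine ⟨⊥, ⊤, fun h => ?_⟩
    have hmem : (1 : F) ∈ (⊥ : Subrepresentation (S p F a)) := by
      rw [h]; trivial
    exact one_ne_zero hmem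
  refine ⟨fun N => ?_⟩
  rcases eq_bot_or_eq_top N.toSubmodule with h | h
  · exact Or.inl (Subrepresentation.toSubmodule_injective h)
  · exact Or.inr (Subrepresentation.toSubmodule_injective h)

variable (p F a)

/-- The inclusion of `S_a` into the homogeneous functions, as the line spanned by `axisFun`. -/
def inclS : (S p F a).IntertwiningMap (res (homRep p F a)) where
  toLinearMap := LinearMap.toSpanSingleton F _ (axisFun p F a)
  isIntertwining' b := LinearMap.ext_ring <| by
    change S p F a b 1 • axisFun p F a = homRep p F a b.1 ((1 : F) • axisFun p F a)
    rw [one_smul, S_apply, mul_one]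
    exact (homRep_axisFun (b := b.1.unop) b.2).symm

/-- The projection of the homogeneous functions to `S_a`, by evaluation at `e₁`. -/
def projS : (res (homRep p F a)).IntertwiningMap (S p F a) where
  toLinearMap := LinearMap.proj e₁ ∘ₗ (homFun p F a).subtype
  isIntertwining' b := LinearMap.ext fun f => by
    have hb : b.1.unop ∈ borel p := b.2
    change f.1 (b.1.unop • e₁) = S p F a b (f.1 e₁)
    rw [S_apply, smul_e₁_of_mem_borel hb, homFun_smul f (apply_zero_zero_ne_zero hb)]

/-- The restriction of homogeneous functions to the line `v 0 = 0`, extended by zero. -/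
def restrictLine : homFun p F a →ₗ[F] homFun p F a where
  toFun f := ⟨fun v => if v 0 = 0 then f.1 v else 0, by simp [f.2.1], fun c v => by
    simp [f.2.2]⟩
  map_add' f g := by
    ext v
    by_cases hv : v 0 = 0 <;> simp [hv]
  map_smul' c f := by
    ext v
    by_cases hv : v 0 = 0 <;> simp [hv]

/-- Upper triangular matrices, parametrized by their first row. -/
def borelEquiv : (ZMod p)ˣ × ZMod p ≃ Bop p where
  toFun x := ⟨MulOpposite.op ⟨!![(x.1 : ZMod p), x.2; 0, (x.1 : ZMod p)⁻¹], by
    rw [Matrix.det_fin_two_of, mul_inv_cancel₀ x.1.ne_zero, mul_zero, sub_zero]⟩, rfl⟩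
  invFun b := (Units.mk0 _ (apply_zero_zero_ne_zero b.2), b.1.unop 0 1)
  left_inv x := Prod.ext (Units.ext rfl) rfl
  right_inv b := by
    refine Subtype.ext (MulOpposite.unop_injective ?_)
    ext i j
    fin_cases i <;> fin_cases j
    · rfl
    · rfl
    · exact (mem_borel.1 b.2).symm
    · exact inv_eq_of_mul_eq_one_right (mul_eq_one_of_mem_borel b.2)

variable {p F a}

theorem projS_inclS : Function.LeftInverse (projS p F a) (inclS p F a) := fun x => by
  change x * (axisFun p F a).1 e₁ = x
  rw [axisFun_e₁, mul_one]

theorem sum_borel_ite [Fintype (Bop p)] {v : Plane p} (hv : v 1 ≠ 0) (x : F) :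
    ∑ b : Bop p, (if (b.1.unop • v) 0 = 0 then x else 0) = -x := by
  have hrow (c : (ZMod p)ˣ) (β : ZMod p) :
      ((borelEquiv p (c, β)).1.unop • v) 0 = 0 ↔ β = -(c * v 0) / v 1 := by
    rw [smul_plane_apply, eq_div_iff hv, eq_neg_iff_add_eq_zero, add_comm]
    rfl
  rw [← (borelEquiv p).sum_comp, Fintype.sum_prod_type, ← sum_units_smul (p := p) F]
  simp only [hrow, Finset.sum_ite_eq', Finset.mem_univ, if_true]

theorem sum_restrictLine [Fintype (Bop p)] {f : homFun p F a} (hf : f.1 e₁ = 0) :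
    ∑ b : Bop p, homRep p F a (b⁻¹ : Bop p).1 (restrictLine p F a (homRep p F a b.1 f)) = -f := by
  ext v
  have hterm (b : Bop p) : (homRep p F a (b⁻¹ : Bop p).1
      (restrictLine p F a (homRep p F a b.1 f))).1 v =
      if ((b⁻¹ : Bop p).1.unop • v) 0 = 0 then f.1 v else 0 := by
    refine if_congr Iff.rfl ?_ rfl
    rw [homRep_apply, Subgroup.coe_inv, MulOpposite.unop_inv, smul_inv_smul]
  rw [Submodule.coe_sum, Finset.sum_apply, Finset.sum_congr rfl fun b _ => hterm b]
  refine (Equiv.sum_comp (Equiv.inv (Bop p)) fun b : Bop p =>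
    if (b.1.unop • v) 0 = 0 then f.1 v else 0).trans ?_
  by_cases hv : v 1 = 0
  · simp [homFun_apply_of_eq_zero f hv, hf]
  · exact sum_borel_ite hv _

theorem isSumProjective_res_homRep :
    IsSumProjective F[Bop p] (res (homRep p F a)).asModule (S p F a).asModule := by
  have : Fintype (Bop p) := Fintype.ofFinite _
  refine isSumProjective_of_intertwiningMap projS_inclS (-restrictLine p F a) (fun f _ => ?_)
    fun f hf => ?_
  · change -(if (e₁ : Plane p) 0 = 0 then f.1 e₁ else 0) = 0
    simp [e₁]
  · simp only [LinearMap.neg_apply, map_neg, Finset.sum_neg_distrib, neg_eq_iff_eq_neg]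
    exact sum_restrictLine hf

theorem isSumProjective_res_ind :
    IsSumProjective F[Bop p] (res (ind (S p F a))).asModule (S p F a).asModule := by
  let e : (res (ind (S p F a))).Equiv (res (homRep p F a)) :=
    Representation.Equiv.mk (indEquiv p F a).toLinearEquiv fun b =>
      (indEquiv p F a).toIntertwiningMap.isIntertwining' b.1
  exact isSumProjective_res_homRep.of_linearEquiv (toModuleEquiv e)

theorem isGreenCorrespondent_ind
    (h : IsIndecomposable F[(G p)ᵐᵒᵖ] (ind (S p F a)).asModule) :
    IsGreenCorrespondent (ind (S p F a)) (S p F a) where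
  indecomposable := h
  not_projective _ :=
    not_projective_homRep (Module.Projective.of_equiv (toModuleEquiv (indEquiv p F a)))
  indecomposable' :=
    have := isSimpleModule_S (p := p) (F := F) (a := a)
    have := IsSimpleModule.nontrivial F[Bop p] (S p F a).asModule
    isUniserial_of_isSimpleModule.isIndecomposable
  not_projective' := not_projective_S
  res_eq := isSumProjective_res_ind
  ind_eq := isSumProjective_self

end GreenCorrespondence

end SLTwo

end

open SLTwo in
theorem mainTheorem9_general (p : ℕ) [Fact p.Prime] (F : Type*) [Field F] [CharP F p] (a : ℕ)
    (ha : a < p) :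
    HasCompositionFactors F[(G p)ᵐᵒᵖ] (ind (S p F a)).asModule
      (fun i : Fin 2 => (V p F (![a + 1, p - a] i)).asModule) ∧
    (a ≠ 0 → a ≠ p - 1 →
      IsUniserial F[(G p)ᵐᵒᵖ] (ind (S p F a)).asModule ∧
      Nonempty (socle F[(G p)ᵐᵒᵖ] (ind (S p F a)).asModule
        ≃ₗ[F[(G p)ᵐᵒᵖ]] (V p F (a + 1)).asModule) ∧
      Nonempty (Top F[(G p)ᵐᵒᵖ] (ind (S p F a)).asModule
        ≃ₗ[F[(G p)ᵐᵒᵖ]] (V p F (p - a)).asModule) ∧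
      IsGreenCorrespondent (ind (S p F a)) (S p F a) ∧
      ∀ (W : Type*) [AddCommGroup W] [Module F W] (ρ : Representation F (G p)ᵐᵒᵖ W),
        IsGreenCorrespondent ρ (S p F a) →
          Nonempty (ρ.asModule ≃ₗ[F[(G p)ᵐᵒᵖ]] (ind (S p F a)).asModule)) := by
  have := isSimpleModule_formSubmodule (F := F) ha
  have := isSimpleModule_quotient_formSubmodule (F := F) ha
  refine ⟨hasCompositionFactors_of_isSimpleModule
    (fun i => (V p F (![a + 1, p - a] i)).asModule) (formSubmoduleEquiv ha)
    (quotientFormSubmoduleEquiv ha), fun ha0 ha1 => ?_⟩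
  have hK := not_isComplemented_formSubmodule (F := F) ha0 (by omega : a < p - 1)
  have hind := isIndecomposable_of_not_isComplemented hK
  refine ⟨isUniserial_of_not_isComplemented hK,
    ⟨(LinearEquiv.ofEq _ _ (socle_eq_of_not_isComplemented hK)).trans (formSubmoduleEquiv ha)⟩,
    ⟨(Submodule.quotEquivOfEq _ _ (jacobson_eq_of_not_isComplemented hK)).trans
      (quotientFormSubmoduleEquiv ha)⟩,
    isGreenCorrespondent_ind hind, fun W _ _ ρ hρ => ?_⟩
  have := hρ.indecomposable.1
  exact hρ.ind_eq.nonempty_linearEquiv hind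

open SLTwo in
theorem mainTheorem9 (p : ℕ) [Fact p.Prime] (hp : p ≠ 2)
    (F : Type*) [Field F] [IsAlgClosed F] [CharP F p] (a : ℕ) (ha : a ≤ p - 2) :
    HasCompositionFactors F[(G p)ᵐᵒᵖ] (ind (S p F a)).asModule
      (fun i : Fin 2 => (V p F (![a + 1, p - a] i)).asModule) ∧
    (a ≠ 0 →
      IsUniserial F[(G p)ᵐᵒᵖ] (ind (S p F a)).asModule ∧
      Nonempty (socle F[(G p)ᵐᵒᵖ] (ind (S p F a)).asModule
        ≃ₗ[F[(G p)ᵐᵒᵖ]] (V p F (a + 1)).asModule) ∧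
      Nonempty (Top F[(G p)ᵐᵒᵖ] (ind (S p F a)).asModule
        ≃ₗ[F[(G p)ᵐᵒᵖ]] (V p F (p - a)).asModule) ∧
      IsGreenCorrespondent (ind (S p F a)) (S p F a) ∧
      ∀ (W : Type*) [AddCommGroup W] [Module F W] (ρ : Representation F (G p)ᵐᵒᵖ W),
        IsGreenCorrespondent ρ (S p F a) →
          Nonempty (ρ.asModule ≃ₗ[F[(G p)ᵐᵒᵖ]] (ind (S p F a)).asModule)) := by
  have hp2 := (Fact.out : p.Prime).two_le
  have h := mainTheorem9_general p F a (by omega)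
  exact ⟨h.1, fun ha0 => h.2 ha0 (by omega)⟩
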